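/- Let $G=(V,E)$ be a finite simple graph, $n=|V|$. For $c\in\mathbb R^{E}$ let $F(G,c)$ be the set of real positive semidefinite $V\times V$ matrices $X$ with $X[i,i]=1$ for all $i\in V$ and $X[i,j]=c(ij)$ for all $ij\in E$ (the feasible set of the PSD matrix completion problem $\mathrm P(G,c)$), and let $\mathcal E(G)=\{c\in\mathbb R^E\mid F(G,c)\neq\emptyset\}$. For $\omega\in\mathbb R^{V\cup E}$ put $\Omega=\sum_{i\in V}\omega(i)E_{ii}+\sum_{ij\in E}\omega(ij)E_{ij}$, where $E_{ij}=(e_ie_j^{\top}+e_je_i^{\top})/2$. For $c\in\mathcal E(G)$, the singularity degree $\mathsf{sd}(G,c)$ is the smallest $k\ge 0$ for which there are $\omega^1,\dots,\omega^k\in\mathbb R^{V\cup E}$ such that, with $\mathcal V^j=\{x\in\mathbb R^V\mid x^{\top}\Omega^i x=0\ (1\le i\le j)\}$ (so $\mathcal V^0=\mathbb R^V$): 1. $x^{\top}\Omega^j x\ge 0$ for all $x\in\mathcal V^{j-1}$, $1\le j\le k$ (under this condition every $\mathcal V^j$ is a linear subspace); 2. $\sum_{i\in V}\omega^j(i)+\sum_{ij\in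 E}\omega^j(ij)c(ij)\le 0$ for $1\le j\le k$; 3. $\dim\mathcal V^k$ equals the rank of a relative interior point of $F(G,c)$. In particular $\mathsf{sd}(G,c)=0$ if and only if $F(G,c)$ contains a positive definite matrix. Let $\mathsf{sd}(G)=\max\{\mathsf{sd}(G,c)\mid c\in\mathcal E(G)\}$. The graph $G$ is chordal if it has no induced cycle of length at least four. Theorem. For every finite simple graph $G$, $\mathsf{sd}(G)\le 1$ if and only if $G$ is chordal. -/

import Mathlib

/-!  The positive semidefinite matrix completion problem P(G, c) of a finite simple graph `G`
with edge weights `c` (unit diagonal), its facial reduction, and the singularity degree. -/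

namespace PSDCompletion

/-- The feasible set of P(G, c): real positive semidefinite matrices `X` with unit diagonal and
`X[i,j] = c(ij)` for every edge `ij`. -/
def feasibleSet {V : Type*} (G : SimpleGraph V) (c : G.edgeSet → ℝ) : Set (Matrix V V ℝ) :=
  {X | X.PosSemidef ∧ (∀ i, X i i = 1) ∧ ∀ i j (h : G.Adj i j), X i j = c ⟨s(i, j), h⟩}

/-- The set `ℰ(G)` of edge weights for which P(G, c) is feasible, i.e. the coordinate
projection of the elliptope (the unit-diagonal positive semidefinite matrices). -/
def feasibleWeights {V : Type*} (G : SimpleGraph V) : Set (G.edgeSet → ℝ) :=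
  {c | (feasibleSet G c).Nonempty}

open Classical in
/-- For dual variables `ω ∈ ℝ^{V ∪ E}`, the matrix
`Ω = ∑_{i ∈ V} ω(i) E_ii + ∑_{ij ∈ E} ω(ij) E_ij` with `E_ij = (e_i e_jᵀ + e_j e_iᵀ) / 2`,
given entrywise. -/
noncomputable def stressMatrix {V : Type*} (G : SimpleGraph V) (ω : V ⊕ G.edgeSet → ℝ) :
    Matrix V V ℝ :=
  Matrix.of fun i j =>
    if i = j then ω (Sum.inl i)
    else if h : G.Adj i j then ω (Sum.inr ⟨s(i, j), h⟩) / 2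
    else 0

open Classical in
/-- The objective value `∑_{i ∈ V} ω(i) + ∑_{ij ∈ E} ω(ij) c(ij)` of the dual problem. -/
noncomputable def dualValue {V : Type*} [Fintype V] (G : SimpleGraph V) (c : G.edgeSet → ℝ)
    (ω : V ⊕ G.edgeSet → ℝ) : ℝ :=
  ∑ i, ω (Sum.inl i) + ∑ e : G.edgeSet, ω (Sum.inr e) * c e

/-- `𝒱ʲ = {x ∈ ℝ^V | xᵀ Yⁱ x = 0 for the first j matrices Yⁱ of the sequence}`;
in particular `𝒱⁰ = ℝ^V`. -/
def nullCone {V : Type*} [Fintype V] {k : ℕ} (Y : Fin k → Matrix V V ℝ) (j : ℕ) :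
    Set (V → ℝ) :=
  {x | ∀ i : Fin k, (i : ℕ) < j → x ⬝ᵥ (Y i).mulVec x = 0}

/-- A sequence of symmetric matrices is nested PSD if each matrix is positive semidefinite on the
space `𝒱` cut out by its predecessors. -/
def IsNestedPSD {V : Type*} [Fintype V] {k : ℕ} (Y : Fin k → Matrix V V ℝ) : Prop :=
  ∀ j : Fin k, (Y j).IsSymm ∧ ∀ x ∈ nullCone Y j, 0 ≤ x ⬝ᵥ (Y j).mulVec x

/-- A (complete) facial reduction sequence of length `k` for P(G, c): dual vectors
`ω¹, …, ωᵏ` such that `Ω¹, …, Ωᵏ` is nested PSD, each dual value is nonpositive, and the dimension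
of the final space `𝒱ᵏ` is the rank of a (relative) interior point of the feasible set.  There is
no sign condition on the `ωʲ`, since all linear constraints of P(G, c) are equations.
The set `𝒱ᵏ` of a nested PSD sequence is a linear subspace, so `Set.finrank` is its dimension.
For `k = 0` the conditions say that an interior point is positive definite. -/
def IsFacialReduction {V : Type*} [Fintype V] (G : SimpleGraph V) (c : G.edgeSet → ℝ) {k : ℕ}
    (ω : Fin k → V ⊕ G.edgeSet → ℝ) : Prop :=
  IsNestedPSD (fun j => stressMatrix G (ω j)) ∧
  (∀ j, dualValue G c (ω j) ≤ 0) ∧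
  ∃ X ∈ intrinsicInterior ℝ (feasibleSet G c),
    (nullCone (fun j => stressMatrix G (ω j)) k).finrank ℝ = X.rank

/-- The singularity degree `sd(G, c)` of P(G, c): the smallest length of a facial reduction
sequence (`⊤` if there were none, which does not happen for feasible problems). -/
noncomputable def weightSingularityDegree {V : Type*} [Fintype V] (G : SimpleGraph V)
    (c : G.edgeSet → ℝ) : ℕ∞ :=
  ⨅ (k : ℕ) (_ : ∃ ω : Fin k → V ⊕ G.edgeSet → ℝ, IsFacialReduction G c ω), (k : ℕ∞)

/-- The singularity degree `sd(G)`: the largest `sd(G, c)` over all `c ∈ ℰ(G)`. -/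
noncomputable def singularityDegree {V : Type*} [Fintype V] (G : SimpleGraph V) : ℕ∞ :=
  ⨆ c ∈ feasibleWeights G, weightSingularityDegree G c

/-- A graph is chordal if it has no hole, i.e. no induced cycle of length at least four. -/
def IsChordal {V : Type*} (G : SimpleGraph V) : Prop :=
  ∀ n : ℕ, 4 ≤ n → IsEmpty (SimpleGraph.cycleGraph n ↪g G)

end PSDCompletion

/-!
A facial reduction sequence of length at most one is the same thing as a completion `X` and a
positive semidefinite stress `Ω` with `ker Ω = range X`, i.e. a strictly complementary pair. So the
theorem says that `G` is chordal iff every feasible problem has such a pair.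

If `G` is chordal, let `Ω` be a sum of `w wᵀ` over enough clique-supported vectors `w` with
`wᵀ A w = 0`. For `x ∈ ker Ω`, the matrix `A - ε x xᵀ` is still positive semidefinite on cliques
for small `ε > 0`, hence has a completion by the theorem of Grone, Johnson, Sá and Wolkowicz (extend
along a perfect elimination ordering). Adding `ε x xᵀ` back gives a completion of `A` whose kernel
is orthogonal to `x`; thus `x` lies in the range of every relative interior point.

If `G` has a hole, take unit vectors in the plane along it, `(1,0)` twice, then `(3/5,4/5)`, then
`(0,1)` throughout. Every completion is forced to kill `3 e₀ + 4 e₃ - 5 e₂`, but no stress detects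
this: a positive semidefinite `Ω` orthogonal to the Gram matrix has zero column at vertex `2`.
-/

namespace PSDCompletion

open SimpleGraph Matrix

variable {V : Type*}

theorem cycleGraph_adj_zero_succ {n : ℕ} (i : Fin (n + 1)) :
    (cycleGraph (n + 2)).Adj 0 i.succ ↔ i = 0 ∨ i = Fin.last n := by
  rw [cycleGraph_adj, sub_zero, zero_sub, neg_eq_iff_eq_neg, or_comm,
    ← Fin.succ_zero_eq_one, Fin.succ_inj, Fin.succ_zero_eq_one, Fin.ext_iff (b := -1),
    Fin.coe_neg_one, Fin.val_succ, Nat.add_right_cancel_iff, Fin.ext_iff (b := Fin.last n),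
    Fin.val_last]

theorem cycleGraph_adj_succ_succ {n : ℕ} (i j : Fin (n + 1)) :
    (cycleGraph (n + 2)).Adj i.succ j.succ ↔ (pathGraph (n + 1)).Adj i j := by
  have val_sub_eq_one (i j : Fin (n + 1)) : (i.succ - j.succ).val = 1 ↔ j.val + 1 = i := by
    rcases le_or_gt j i with h | h
    · rw [Fin.sub_val_of_le (Fin.succ_le_succ_iff.2 h), Fin.val_succ, Fin.val_succ]
      omega
    · rw [Fin.coe_sub_iff_lt.2 (Fin.succ_lt_succ_iff.2 h), Fin.val_succ, Fin.val_succ]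
      omega
  rw [cycleGraph_adj', pathGraph_adj, val_sub_eq_one, val_sub_eq_one, or_comm]

theorem nonempty_cycleGraph_embedding {n : ℕ} {G : SimpleGraph V} (p : pathGraph (n + 1) ↪g G)
    {t : V} (hpt : ∀ i, p i ≠ t) (ht : ∀ i, G.Adj t (p i) ↔ i = 0 ∨ i = Fin.last n) :
    Nonempty (cycleGraph (n + 2) ↪g G) := by
  refine ⟨⟨⟨Fin.cons t p, Fin.cons_injective_iff.2 ⟨by simpa using hpt, p.injective⟩⟩, ?_⟩⟩
  intro u v
  cases u using Fin.cases <;> cases v using Fin.cases <;>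
    simp [cycleGraph_adj_zero_succ, cycleGraph_adj_succ_succ, ht, adj_comm _ _ t,
      adj_comm _ _ (0 : Fin (n + 2))]

theorem exists_pathGraph_embedding {H : SimpleGraph V} {x y : V} (h : H.Reachable x y) :
    ∃ (n : ℕ) (p : pathGraph (n + 1) ↪g H), p 0 = x ∧ p (Fin.last n) = y := by
  obtain ⟨w, hw⟩ := h.exists_walk_length_eq_dist
  have dist_getVert (i : Fin (H.dist x y + 1)) : H.dist x (w.getVert i) = i := by
    have hi : H.dist x (w.getVert i) ≤ i := (dist_le (w.take i)).trans (by simp [Walk.take_length])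
    have hi' : H.dist (w.getVert i) y ≤ H.dist x y - i :=
      (dist_le (w.drop i)).trans (by simp [Walk.drop_length, hw])
    have := Reachable.dist_triangle_left ⟨w.take i⟩ y
    omega
  have adj_getVert (i j : Fin (H.dist x y + 1)) (hij : i.val + 1 = j) :
      H.Adj (w.getVert i) (w.getVert j) := by
    rw [← hij]
    exact w.adj_getVert_succ (by omega)
  refine ⟨H.dist x y, ⟨⟨fun i => w.getVert i, fun i j hij => ?_⟩, fun {i j} => ?_⟩,
    w.getVert_zero, ?_⟩
  · rw [Fin.ext_iff, ← dist_getVert, ← dist_getVert j]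
    exact congrArg (H.dist x) hij
  · rw [pathGraph_adj]
    refine ⟨fun hij => ?_, fun hij => ?_⟩
    · have hne : i.val ≠ j := fun h => hij.ne (congrArg w.getVert h)
      have hdist := Adj.diff_dist_adj (u := x) (v := w.getVert i) (w := w.getVert j) hij
      simp only [dist_getVert] at hdist
      omega
    · exact hij.elim (adj_getVert i j) fun hji => (adj_getVert j i hji).symm
  · change w.getVert (H.dist x y) = y
    rw [← hw, w.getVert_length]

theorem IsChordal.adj_of_connected {G : SimpleGraph V} (hG : IsChordal G) {C : Set V} {t x y : V}
    (hC : (G.induce (C ∪ {x, y})).Connected) (htC : ∀ c ∈ C, c ≠ t ∧ ¬ G.Adj t c)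
    (hx : G.Adj t x) (hy : G.Adj t y) (hxy : x ≠ y) : G.Adj x y := by
  by_contra hnadj
  obtain ⟨n, p, hp0, hpn⟩ := exists_pathGraph_embedding (hC ⟨x, by simp⟩ ⟨y, by simp⟩)
  have two_le : 2 ≤ n := by
    by_contra! hn
    interval_cases n
    · exact hxy (congrArg Subtype.val (hp0.symm.trans hpn))
    · have : (induce (C ∪ {x, y}) G).Adj (p 0) (p (Fin.last 1)) :=
        p.map_adj_iff.2 (pathGraph_adj.2 (by simp))
      rw [hp0, hpn] at this
      exact hnadj this
  have adj_iff (i) : G.Adj t (p i) ↔ i = 0 ∨ i = Fin.last n := by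
    refine ⟨fun h => ?_, ?_⟩
    · rcases (p i).2 with hi | hi | hi
      · exact absurd h (htC _ hi).2
      · exact .inl (p.injective ((Subtype.ext hi).trans hp0.symm))
      · exact .inr (p.injective ((Subtype.ext (Set.mem_singleton_iff.1 hi)).trans hpn.symm))
    · rintro (rfl | rfl)
      · exact hp0 ▸ hx
      · exact hpn ▸ hy
  have ne_t (i) : (p i : V) ≠ t := by
    rcases (p i).2 with hi | hi | hi
    · exact (htC _ hi).1
    · exact ne_of_eq_of_ne hi hx.ne'
    · exact ne_of_eq_of_ne hi hy.ne'
  obtain ⟨φ⟩ := nonempty_cycleGraph_embedding (p.trans (Embedding.induce _)) ne_t adj_iff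
  exact (hG (n + 2) (by omega)).false φ

theorem exists_connected_induce_closed [Finite V] (G : SimpleGraph V) {D : Set V} {a : V}
    (ha : a ∈ D) : ∃ C ⊆ D, a ∈ C ∧ (G.induce C).Connected ∧
      ∀ c ∈ C, ∀ u ∈ D, G.Adj c u → u ∈ C := by
  obtain ⟨C, haC, ⟨hCD, hC⟩, hmax⟩ := (Set.toFinite {C | C ⊆ D ∧ (G.induce C).Connected})
    |>.exists_le_maximal (a := {a}) ⟨by simpa using ha, by simp⟩
  refine ⟨C, hCD, haC rfl, hC, fun c hc u hu hcu => ?_⟩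
  have hconn : (G.induce (C ∪ {u})).Connected :=
    connected_induce_union hC.preconnected (by simp) hc rfl hcu
  exact hmax ⟨by simp [Set.insert_subset_iff, hu, hCD], hconn⟩ Set.subset_union_left (.inr rfl)

theorem IsChordal.exists_clique_separator [Finite V] {G : SimpleGraph V} (hG : IsChordal G)
    {S : Set V} {t a : V} (ht : t ∈ S) (ha : a ∈ S) (hat : a ≠ t) (hta : ¬ G.Adj t a) :
    ∃ C U : Set V, C ∪ U ⊂ S ∧ a ∈ C ∧ (∀ c ∈ C, c ≠ t ∧ ¬ G.Adj t c) ∧ G.IsClique U ∧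
      ∀ c ∈ C, ∀ u ∈ S, G.Adj c u → u ∈ C ∪ U := by
  obtain ⟨C, hCD, haC, hC, hclosed⟩ := exists_connected_induce_closed G
    (D := {u ∈ S | u ≠ t ∧ ¬ G.Adj t u}) ⟨ha, hat, hta⟩
  have htC (c) (hc : c ∈ C) : c ≠ t ∧ ¬ G.Adj t c := (hCD hc).2
  let U : Set V := {u ∈ S | u ∉ C ∧ ∃ c ∈ C, G.Adj c u}
  have htU (u) (hu : u ∈ U) : G.Adj t u := by
    obtain ⟨huS, huC, c, hc, hcu⟩ := hu
    by_contra htu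
    exact huC (hclosed c hc u ⟨huS, fun h => (htC c hc).2 (h ▸ hcu.symm), htu⟩ hcu)
  refine ⟨C, U, ⟨Set.union_subset (fun c hc => (hCD hc).1) (fun u hu => hu.1), fun h => ?_⟩,
    haC, htC, fun x hx y hy hxy => ?_, fun c hc u hu hcu => ?_⟩
  · exact (h ht).elim (fun htC' => (htC t htC').1 rfl) fun htU' => (htU t htU').ne rfl
  · obtain ⟨-, -, c, hc, hcx⟩ := id hx
    obtain ⟨-, -, d, hd, hdy⟩ := id hy
    have hCx : (G.induce (C ∪ {x})).Connected :=
      connected_induce_union hC.preconnected (by simp) hc rfl hcx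
    have hCxy : (G.induce (C ∪ {x} ∪ {y})).Connected :=
      connected_induce_union hCx.preconnected (by simp) (.inl hd) rfl hdy
    rw [Set.union_assoc] at hCxy
    exact hG.adj_of_connected hCxy htC (htU x hx) (htU y hy) hxy
  · exact or_iff_not_imp_left.2 fun huC => ⟨hu, huC, c, hc, hcu⟩

/-- `v` is a simplicial vertex relative to `S`: its neighbours in `S` form a clique. The vertex `v`
need not lie in `S`, so that the notion serves both for deleting `v` from `S` and for adding it. -/
def IsSimplicial (G : SimpleGraph V) (S : Set V) (v : V) : Prop :=
  G.IsClique {u ∈ S | G.Adj v u}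

theorem IsSimplicial.of_forall_mem {G : SimpleGraph V} {S T : Set V} {v : V}
    (h : IsSimplicial G T v) (hST : ∀ u ∈ S, G.Adj v u → u ∈ T) : IsSimplicial G S v :=
  fun _ hx _ hy => h ⟨hST _ hx.1 hx.2, hx.2⟩ ⟨hST _ hy.1 hy.2, hy.2⟩

theorem IsChordal.exists_isSimplicial_not_adj [Finite V] {G : SimpleGraph V} (hG : IsChordal G)
    {S : Set V} {t a : V} (ht : t ∈ S) (ha : a ∈ S) (hat : a ≠ t) (hta : ¬ G.Adj t a) :
    ∃ w ∈ S, IsSimplicial G S w ∧ w ≠ t ∧ ¬ G.Adj t w := by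
  induction S using WellFoundedLT.induction generalizing t a with
  | ind S ih =>
  obtain ⟨C, U, hCU, haC, htC, hU, hnhd⟩ := hG.exists_clique_separator ht ha hat hta
  suffices ∃ w ∈ C, IsSimplicial G (C ∪ U) w by
    obtain ⟨w, hw, hsimp⟩ := this
    exact ⟨w, hCU.1 (.inl hw), hsimp.of_forall_mem (hnhd w hw), htC w hw⟩
  by_cases hclique : G.IsClique (C ∪ U)
  · exact ⟨a, haC, hclique.subset (Set.sep_subset _ _)⟩
  obtain ⟨x, hx, y, hy, hxy, hnadj⟩ : ∃ x ∈ C ∪ U, ∃ y ∈ C ∪ U, x ≠ y ∧ ¬ G.Adj x y := by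
    simpa [SimpleGraph.IsClique, Set.Pairwise] using hclique
  obtain ⟨w, hw, hwsimp, hwx, hxw⟩ := ih _ hCU hx hy hxy.symm hnadj
  refine hw.elim (fun hwC => ⟨w, hwC, hwsimp⟩) fun hwU => ?_
  obtain ⟨z, hz, hzsimp, hzw, hwz⟩ := ih _ hCU hw hx hwx.symm (mt Adj.symm hxw)
  exact ⟨z, hz.resolve_right fun hzU => hwz (hU hwU hzU hzw.symm), hzsimp⟩

theorem IsChordal.exists_isSimplicial [Finite V] {G : SimpleGraph V} (hG : IsChordal G)
    {S : Set V} (hS : S.Nonempty) : ∃ v ∈ S, IsSimplicial G S v := by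
  by_cases hclique : G.IsClique S
  · exact hS.imp fun v hv => ⟨hv, hclique.subset (Set.sep_subset _ _)⟩
  · obtain ⟨t, ht, a, ha, hta, hnadj⟩ : ∃ t ∈ S, ∃ a ∈ S, t ≠ a ∧ ¬ G.Adj t a := by
      simpa [SimpleGraph.IsClique, Set.Pairwise] using hclique
    obtain ⟨v, hv, hsimp, -⟩ := hG.exists_isSimplicial_not_adj ht ha hta.symm hnadj
    exact ⟨v, hv, hsimp⟩

theorem IsChordal.perfectElimination_induction [Finite V] {G : SimpleGraph V} (hG : IsChordal G)
    {p : Set V → Prop} (empty : p ∅)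
    (insert : ∀ v S, v ∉ S → IsSimplicial G S v → p S → p (insert v S)) (S : Set V) : p S := by
  induction S using WellFoundedLT.induction with
  | ind S ih =>
  obtain rfl | hS := S.eq_empty_or_nonempty
  · exact empty
  obtain ⟨v, hv, hsimp⟩ := hG.exists_isSimplicial hS
  rw [← Set.insert_sdiff_self_of_mem hv]
  exact insert v _ (by simp) (hsimp.of_forall_mem fun u hu _ => hu.1)
    (ih _ (Set.sdiff_singleton_ssubset.2 hv))

theorem exists_apply_eq_of_isSymm {K E : Type*} [Field K] [AddCommGroup E] [Module K E]
    [FiniteDimensional K E] {B : LinearMap.BilinForm K E} (hB : B.IsSymm) {f : Module.Dual K E}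
    (hf : ∀ z, B z = 0 → f z = 0) : ∃ y, B y = f := by
  have hmem : f ∈ (LinearMap.ker B).dualAnnihilator :=
    (Submodule.mem_dualAnnihilator f).2 hf
  rw [LinearMap.dualAnnihilator_ker_eq_range_flip] at hmem
  obtain ⟨y, rfl⟩ := hmem
  exact ⟨y, LinearMap.ext fun z => hB.eq y z⟩

section BilinForm

variable {K E : Type*} [Field K] [LinearOrder K] [IsStrictOrderedRing K] [AddCommGroup E]
  [Module K E] {B : LinearMap.BilinForm K E}

theorem exists_pos_mul_sq_le_of_posSemidef [FiniteDimensional K E] (hB : B.IsPosSemidef)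
    {f : Module.Dual K E} (hf : ∀ z, B z z = 0 → f z = 0) :
    ∃ ε > 0, ∀ z, ε * f z ^ 2 ≤ B z z := by
  obtain ⟨y, rfl⟩ := exists_apply_eq_of_isSymm hB.isSymm fun z hz =>
    hf z (LinearMap.congr_fun hz z)
  have hy : 0 < B y y + 1 := add_pos_of_nonneg_of_pos (hB.nonneg y) one_pos
  refine ⟨(B y y + 1)⁻¹, inv_pos.2 hy, fun z => ?_⟩
  rw [inv_mul_le_iff₀ hy]
  calc B y z ^ 2 ≤ B y y * B z z :=
        LinearMap.BilinForm.apply_sq_le_of_symm B hB.nonneg ⟨hB.isSymm.eq⟩ y z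
    _ ≤ (B y y + 1) * B z z := by
        gcongr
        · exact hB.nonneg z
        · exact le_add_of_nonneg_right zero_le_one

theorem exists_apply_eq_apply_of_nonneg_sup {W : Submodule K E} [FiniteDimensional K W]
    (hB : B.IsSymm) {v : E} (hWv : ∀ z ∈ W ⊔ K ∙ v, 0 ≤ B z z) :
    ∃ y ∈ W, (∀ z ∈ W, B y z = B v z) ∧ B y y ≤ B v v := by
  have hv : v ∈ W ⊔ K ∙ v := Submodule.mem_sup_right (Submodule.mem_span_singleton_self v)
  have apply_eq_zero (z : W) (hz : B z z = 0) : B v z = 0 := by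
    have hcs := LinearMap.BilinForm.apply_sq_le_of_symm (B.restrict (W ⊔ K ∙ v))
      (fun x => hWv x x.2) ⟨fun x y => hB.eq x y⟩ ⟨v, hv⟩ ⟨z, Submodule.mem_sup_left z.2⟩
    change B v z ^ 2 ≤ B v v * B z z at hcs
    rw [hz, mul_zero] at hcs
    exact (pow_eq_zero_iff two_ne_zero).1 (hcs.antisymm (sq_nonneg _))
  obtain ⟨⟨y, hyW⟩, hy⟩ := exists_apply_eq_of_isSymm (B := B.restrict W) ⟨fun x z => hB.eq x z⟩
    (f := (B v).domRestrict W) fun z hz => apply_eq_zero z (LinearMap.congr_fun hz z)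
  have hy' (z : E) (hz : z ∈ W) : B y z = B v z := LinearMap.congr_fun hy ⟨z, hz⟩
  refine ⟨y, hyW, hy', ?_⟩
  have hsub := hWv (v - y) (sub_mem hv (Submodule.mem_sup_left hyW))
  simp only [map_sub, LinearMap.sub_apply, hy' y hyW, hB.eq y v] at hsub
  rw [hy' y hyW]
  linarith

end BilinForm

theorem isSymm_of_posSemidef {A : Matrix V V ℝ} (hA : A.PosSemidef) : A.IsSymm :=
  isHermitian_iff_isSymm.1 hA.isHermitian

theorem exists_posSemidef_extend [Fintype V] {X : Matrix V V ℝ}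
    (hX : X.PosSemidef) (v : V) {y : V → ℝ} {d : ℝ} (hd : y ⬝ᵥ X *ᵥ y ≤ d) :
    ∃ Z : Matrix V V ℝ, Z.PosSemidef ∧ (∀ i j, i ≠ v → j ≠ v → Z i j = X i j) ∧
      (∀ i, i ≠ v → Z i v = (X *ᵥ y) i) ∧ Z v v = d := by
  classical
  let M : Matrix V V ℝ := updateCol 1 v y
  have col_of_ne {j : V} (hj : j ≠ v) : M.col j = Pi.single j 1 := by
    ext i
    simp [M, updateCol_ne hj, one_eq_pi_single, Pi.single_comm]
  have col_self : M.col v = y := by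
    ext i
    simp [M]
  have mul_apply_eq (i j : V) : (Mᵀ * X * M) i j = M.col i ⬝ᵥ X *ᵥ M.col j := by
    rw [Matrix.mul_assoc]; rfl
  refine ⟨Mᵀ * X * M + diagonal (Pi.single v (d - y ⬝ᵥ X *ᵥ y)), ?_, ?_, ?_, ?_⟩
  · refine (hX.conjTranspose_mul_mul_same M).add (PosSemidef.diagonal ?_)
    exact Pi.single_nonneg.2 (sub_nonneg.2 hd)
  · intro i j hi hj
    simp [mul_apply_eq, col_of_ne hi, col_of_ne hj, diagonal_apply, hi]
  · intro i hi
    simp [mul_apply_eq, col_of_ne hi, col_self, hi]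
  · simp [mul_apply_eq, col_self]

theorem mulVec_apply_congr {R : Type*} [Fintype V] [NonUnitalNonAssocSemiring R]
    {A B : Matrix V V R} {y : V → R} {i : V} (h : ∀ j ∈ Function.support y, A i j = B i j) :
    (A *ᵥ y) i = (B *ᵥ y) i := by
  refine Finset.sum_congr rfl fun j _ => ?_
  by_cases hj : y j = 0
  · rw [hj, mul_zero, mul_zero]
  · exact congrArg (· * y j) (h j hj)

theorem dotProduct_mulVec_congr {R : Type*} [Fintype V] [NonUnitalNonAssocSemiring R]
    {A B : Matrix V V R} {x y : V → R}
    (h : ∀ i ∈ Function.support x, ∀ j ∈ Function.support y, A i j = B i j) :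
    x ⬝ᵥ A *ᵥ y = x ⬝ᵥ B *ᵥ y := by
  refine Finset.sum_congr rfl fun i _ => ?_
  by_cases hi : x i = 0
  · rw [hi, zero_mul, zero_mul]
  · rw [mulVec_apply_congr (h i hi)]

/-- The positive semidefinite matrices that agree with `A` on the diagonal and on the edges
of `G`. -/
def completions (G : SimpleGraph V) (A : Matrix V V ℝ) : Set (Matrix V V ℝ) :=
  {X | X.PosSemidef ∧ ∀ i j, i = j ∨ G.Adj i j → X i j = A i j}

/-- `A` is a `G`-partial positive semidefinite matrix in the sense of Grone, Johnson, Sá and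
Wolkowicz. Its principal submatrices on cliques enter through the vectors supported on a clique;
the entries off the diagonal and the edges are irrelevant (apart from symmetry). -/
structure IsPartialPosSemidef [Fintype V] (G : SimpleGraph V) (A : Matrix V V ℝ) : Prop where
  isSymm : A.IsSymm
  nonneg_of_isClique : ∀ z, G.IsClique (Function.support z) → 0 ≤ z ⬝ᵥ A *ᵥ z

theorem IsPartialPosSemidef.of_posSemidef [Fintype V] (G : SimpleGraph V) {A : Matrix V V ℝ}
    (hA : A.PosSemidef) : IsPartialPosSemidef G A :=
  ⟨isSymm_of_posSemidef hA, fun z _ => hA.dotProduct_mulVec_nonneg z⟩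

theorem IsSimplicial.isClique_insert {G : SimpleGraph V} {S : Set V} {v : V}
    (h : IsSimplicial G S v) : G.IsClique (insert v {u ∈ S | G.Adj v u}) :=
  SimpleGraph.isClique_insert.2 ⟨h, fun _ hu _ => hu.2⟩

theorem IsPartialPosSemidef.exists_mulVec_eq [Fintype V] {G : SimpleGraph V} {A : Matrix V V ℝ}
    (hA : IsPartialPosSemidef G A) {N : Set V} {v : V} (hN : G.IsClique (insert v N)) :
    ∃ y : V → ℝ, Function.support y ⊆ N ∧ (∀ i ∈ N, (A *ᵥ y) i = A i v) ∧
      y ⬝ᵥ A *ᵥ y ≤ A v v := by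
  classical
  have hle : Pi.spanSubset ℝ N ⊔ ℝ ∙ Pi.single v 1 ≤ Pi.spanSubset ℝ (insert v N) := by
    refine sup_le (fun z hz => ?_) (Submodule.span_singleton_le_iff_mem _ _ |>.2 ?_)
    · rw [Pi.mem_spanSubset_iff] at hz ⊢
      exact fun i hi => hz i fun hiN => hi (.inr hiN)
    · rw [Pi.mem_spanSubset_iff]
      exact fun i hi => Pi.single_eq_of_ne (fun h => hi (.inl h)) 1
  obtain ⟨y, hyN, hy, hyv⟩ := exists_apply_eq_apply_of_nonneg_sup (B := toBilin' A)
    (isSymm_toBilin'_iff_isSymm.2 hA.isSymm) fun z hz => by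
      rw [toBilin'_apply']
      refine hA.nonneg_of_isClique z (hN.subset ?_)
      exact Function.support_subset_iff'.2 (Pi.mem_spanSubset_iff.1 (hle hz))
  simp only [toBilin'_apply', single_one_dotProduct, mulVec_single_one] at hy hyv
  refine ⟨y, Function.support_subset_iff'.2 (Pi.mem_spanSubset_iff.1 hyN), fun i hi => ?_, hyv⟩
  have hyi := hy (Pi.single i 1) (Pi.mem_spanSubset_iff.2 fun j hj =>
    Pi.single_eq_of_ne (ne_of_mem_of_not_mem hi hj).symm 1)
  calc (A *ᵥ y) i = y ⬝ᵥ A *ᵥ Pi.single i 1 := by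
        rw [dotProduct_mulVec, ← mulVec_transpose, hA.isSymm.eq, dotProduct_single_one]
    _ = A v i := by rw [hyi, mulVec_single_one]; rfl
    _ = A i v := hA.isSymm.apply i v

theorem IsChordal.completions_nonempty [Fintype V] {G : SimpleGraph V} (hG : IsChordal G)
    {A : Matrix V V ℝ} (hA : IsPartialPosSemidef G A) : (completions G A).Nonempty := by
  classical
  suffices ∀ S : Set V, ∃ X : Matrix V V ℝ, X.PosSemidef ∧
      ∀ i ∈ S, ∀ j ∈ S, i = j ∨ G.Adj i j → X i j = A i j by
    obtain ⟨X, hX, hXA⟩ := this Set.univ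
    exact ⟨X, hX, fun i j => hXA i trivial j trivial⟩
  refine hG.perfectElimination_induction ⟨0, .zero, by simp⟩ ?_
  rintro v S hvS hsimp ⟨X, hX, hXA⟩
  obtain ⟨y, hyN, hy, hle⟩ := hA.exists_mulVec_eq hsimp.isClique_insert
  have hXN (i) (hi : i ∈ {u ∈ S | G.Adj v u}) (j) (hj : j ∈ Function.support y) : X i j = A i j :=
    hXA i hi.1 j (hyN hj).1 ((eq_or_ne i j).imp_right (hsimp hi (hyN hj)))
  obtain ⟨Z, hZ, hZX, hZv, hZvv⟩ := exists_posSemidef_extend hX v (y := y) (d := A v v)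
    ((dotProduct_mulVec_congr fun i hi => hXN i (hyN hi)).trans_le hle)
  have hZA (i) (hi : i ∈ S) (hvi : G.Adj v i) : Z i v = A i v := by
    rw [hZv i hvi.ne', ← hy i ⟨hi, hvi⟩]
    exact mulVec_apply_congr (hXN i ⟨hi, hvi⟩)
  refine ⟨Z, hZ, ?_⟩
  rintro i (rfl | hi) j (rfl | hj) hij
  · exact hZvv
  · have h := hij.resolve_left (by rintro rfl; exact hvS hj)
    rw [← hA.isSymm.apply, ← hZA j hj h]
    exact hZ.isHermitian.apply j i
  · have h := hij.resolve_left (by rintro rfl; exact hvS hi)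
    exact hZA i hi h.symm
  · rw [hZX i j (by rintro rfl; exact hvS hi) (by rintro rfl; exact hvS hj)]
    exact hXA i hi j hj hij

theorem mulVec_eq_zero_iff_of_posSemidef [Fintype V] {A : Matrix V V ℝ}
    (hA : A.PosSemidef) {x : V → ℝ} : A *ᵥ x = 0 ↔ x ⬝ᵥ A *ᵥ x = 0 :=
  (hA.dotProduct_mulVec_zero_iff x).symm

theorem mem_range_mulVecLin_iff_of_isSymm {K : Type*} [Fintype V] [Field K] {X : Matrix V V K}
    (hX : X.IsSymm) {x : V → K} :
    x ∈ LinearMap.range X.mulVecLin ↔ ∀ z, X *ᵥ z = 0 → x ⬝ᵥ z = 0 := by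
  classical
  have mulVec_dotProduct (y z : V → K) : X *ᵥ y ⬝ᵥ z = toBilin' X y z := by
    rw [toBilin'_apply', dotProduct_mulVec, ← mulVec_transpose, hX.eq]
  constructor
  · rintro ⟨y, rfl⟩ z hz
    rw [mulVecLin_apply, mulVec_dotProduct, toBilin'_apply', hz, dotProduct_zero]
  · intro h
    have apply_eq_zero (z : V → K) (hz : toBilin' X z = 0) : x ⬝ᵥ z = 0 :=
      h z (dotProduct_eq_zero _ fun w => (mulVec_dotProduct z w).trans (LinearMap.congr_fun hz w))
    obtain ⟨y, hy⟩ := exists_apply_eq_of_isSymm (isSymm_toBilin'_iff_isSymm.2 hX)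
      (f := dotProductEquiv K V x) apply_eq_zero
    exact ⟨y, dotProduct_eq _ _ fun z => (mulVec_dotProduct y z).trans (LinearMap.congr_fun hy z)⟩

open scoped MatrixOrder in
theorem mul_eq_zero_of_trace_mul_nonpos [Fintype V] {A B : Matrix V V ℝ}
    (hA : A.PosSemidef) (hB : B.PosSemidef) (h : (A * B).trace ≤ 0) : A * B = 0 := by
  classical
  obtain ⟨C, rfl⟩ := CStarAlgebra.nonneg_iff_eq_star_mul_self.1 hA.nonneg
  obtain ⟨D, rfl⟩ := CStarAlgebra.nonneg_iff_eq_star_mul_self.1 hB.nonneg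
  simp only [star_eq_conjTranspose] at h ⊢
  have htrace : (Cᴴ * C * (Dᴴ * D)).trace = ((C * Dᴴ)ᴴ * (C * Dᴴ)).trace := by
    rw [conjTranspose_mul, conjTranspose_conjTranspose, ← Matrix.mul_assoc, trace_mul_comm]
    simp only [Matrix.mul_assoc]
  have hCD : C * Dᴴ = 0 := by
    rw [← trace_conjTranspose_mul_self_eq_zero_iff]
    exact (htrace ▸ h).antisymm (posSemidef_conjTranspose_mul_self _).trace_nonneg
  rw [Matrix.mul_assoc, ← Matrix.mul_assoc C, hCD, Matrix.zero_mul, Matrix.mul_zero]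

theorem eventually_lineMap_mem {E : Type*} [AddCommGroup E] [Module ℝ E] [TopologicalSpace E]
    [IsTopologicalAddGroup E] [ContinuousSMul ℝ E] {s : Set E} {x y : E}
    (hx : x ∈ intrinsicInterior ℝ s) (hy : y ∈ s) :
    ∀ᶠ t in nhds (0 : ℝ), AffineMap.lineMap x y t ∈ s := by
  obtain ⟨p, hp, rfl⟩ := hx
  let γ : ℝ → affineSpan ℝ s := fun t =>
    ⟨AffineMap.lineMap (p : E) y t, AffineMap.lineMap_mem _ p.2 (subset_affineSpan ℝ s hy)⟩
  have hγ : Continuous γ := AffineMap.lineMap_continuous.subtype_mk _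
  have hγ0 : γ 0 = p := Subtype.ext (AffineMap.lineMap_apply_zero _ _)
  exact hγ.continuousAt.eventually (hγ0 ▸ mem_interior_iff_mem_nhds.1 hp)

theorem mulVec_eq_zero_of_mem_intrinsicInterior [Fintype V] {s : Set (Matrix V V ℝ)}
    (hs : ∀ X ∈ s, X.PosSemidef) {X Y : Matrix V V ℝ} (hX : X ∈ intrinsicInterior ℝ s)
    (hY : Y ∈ s) {z : V → ℝ} (hz : X *ᵥ z = 0) : Y *ᵥ z = 0 := by
  obtain ⟨t, hmem, ht⟩ := ((eventually_lineMap_mem hX hY).filter_mono nhdsWithin_le_nhds).and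
    (self_mem_nhdsWithin (s := Set.Iio (0 : ℝ))) |>.exists
  have hline := (hs _ hmem).dotProduct_mulVec_nonneg z
  rw [AffineMap.lineMap_apply_module, add_mulVec, smul_mulVec, smul_mulVec, hz, smul_zero, zero_add,
    dotProduct_smul, smul_eq_mul] at hline
  rw [mulVec_eq_zero_iff_of_posSemidef (hs Y hY)]
  exact (nonpos_of_mul_nonneg_right hline ht).antisymm ((hs Y hY).dotProduct_mulVec_nonneg z)

theorem convex_completions (G : SimpleGraph V) (A : Matrix V V ℝ) : Convex ℝ (completions G A) := by
  intro X hX Y hY a b ha hb hab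
  refine ⟨(hX.1.smul ha).add (hY.1.smul hb), fun i j hij => ?_⟩
  rw [Matrix.add_apply, Matrix.smul_apply, Matrix.smul_apply, hX.2 i j hij, hY.2 i j hij,
    Convex.combo_self hab]

attribute [local instance] Matrix.normedAddCommGroup Matrix.normedSpace in
theorem intrinsicInterior_completions_nonempty [Finite V] {G : SimpleGraph V} {A : Matrix V V ℝ}
    (h : (completions G A).Nonempty) : (intrinsicInterior ℝ (completions G A)).Nonempty := by
  cases nonempty_fintype V
  exact h.intrinsicInterior (convex_completions G A)

/-- `Ω` is a positive semidefinite matrix supported on the diagonal and the edges of `G`, that is,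
the matrix of a dual solution. -/
structure IsPosSemidefStress (G : SimpleGraph V) (Ω : Matrix V V ℝ) : Prop where
  posSemidef : Ω.PosSemidef
  apply_eq_zero : ∀ i j, i ≠ j → ¬ G.Adj i j → Ω i j = 0

/-- The completion problem of `A` and its dual have a strictly complementary pair of solutions: a
completion `X` and a positive semidefinite stress `Ω` with `ΩX = 0` and `rank Ω + rank X = |V|`,
stated as `ker Ω = range X`. -/
def HasStrictlyComplementaryPair [Fintype V] (G : SimpleGraph V) (A : Matrix V V ℝ) : Prop :=
  ∃ X ∈ completions G A, ∃ Ω, IsPosSemidefStress G Ω ∧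
    LinearMap.ker Ω.mulVecLin = LinearMap.range X.mulVecLin

theorem exists_isPosSemidefStress_mulVec_eq_zero_iff [Fintype V] {G : SimpleGraph V}
    {W : Set (V → ℝ)} (hW : ∀ w ∈ W, G.IsClique (Function.support w)) :
    ∃ Ω, IsPosSemidefStress G Ω ∧ ∀ x, Ω *ᵥ x = 0 ↔ ∀ w ∈ W, x ⬝ᵥ w = 0 := by
  classical
  obtain ⟨t, htW, ht⟩ := (Submodule.fg_span_iff_fg_span_finset_subset _).1
    (IsNoetherian.noetherian (Submodule.span ℝ W))
  have hΩ : (∑ w ∈ t, vecMulVec w w).PosSemidef := posSemidef_sum _ fun w _ => by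
    simpa using posSemidef_vecMulVec_self_star w
  have hform (x : V → ℝ) : x ⬝ᵥ (∑ w ∈ t, vecMulVec w w) *ᵥ x = ∑ w ∈ t, (x ⬝ᵥ w) ^ 2 := by
    simp [sum_mulVec, dotProduct_sum, vecMulVec_mulVec, sq, dotProduct_comm _ x]
  have forall_iff (x : V → ℝ) : (∀ w ∈ W, x ⬝ᵥ w = 0) ↔ ∀ w ∈ t, x ⬝ᵥ w = 0 :=
    calc (∀ w ∈ W, x ⬝ᵥ w = 0) ↔ Submodule.span ℝ W ≤ LinearMap.ker (dotProductEquiv ℝ V x) :=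
          by rw [Submodule.span_le]; rfl
      _ ↔ ∀ w ∈ t, x ⬝ᵥ w = 0 := by rw [ht, Submodule.span_le]; rfl
  refine ⟨_, ⟨hΩ, fun i j hij hadj => ?_⟩, fun x => ?_⟩
  · rw [Matrix.sum_apply]
    refine Finset.sum_eq_zero fun w hw => ?_
    by_contra hne
    exact hadj (hW w (htW hw) (left_ne_zero_of_mul hne) (right_ne_zero_of_mul hne) hij)
  · rw [mulVec_eq_zero_iff_of_posSemidef hΩ, hform, forall_iff,
      Finset.sum_eq_zero_iff_of_nonneg fun _ _ => sq_nonneg _]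
    simp only [sq_eq_zero_iff]

/-- The clique-supported vectors that are isotropic for `A`. Membership depends only on the entries
of `A` on the diagonal and the edges, and every completion annihilates these vectors. -/
def cliqueKernel [Fintype V] (G : SimpleGraph V) (A : Matrix V V ℝ) : Set (V → ℝ) :=
  {w | G.IsClique (Function.support w) ∧ w ⬝ᵥ A *ᵥ w = 0}

theorem dotProduct_mulVec_eq_of_mem_completions [Fintype V] {G : SimpleGraph V}
    {A X : Matrix V V ℝ} (hX : X ∈ completions G A) {z : V → ℝ}
    (hz : G.IsClique (Function.support z)) : z ⬝ᵥ X *ᵥ z = z ⬝ᵥ A *ᵥ z :=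
  dotProduct_mulVec_congr fun i hi j hj => hX.2 i j ((eq_or_ne i j).imp_right (hz hi hj))

theorem mulVec_eq_zero_of_mem_cliqueKernel [Fintype V] {G : SimpleGraph V}
    {A X : Matrix V V ℝ} (hX : X ∈ completions G A) {w : V → ℝ} (hw : w ∈ cliqueKernel G A) :
    X *ᵥ w = 0 := by
  rw [mulVec_eq_zero_iff_of_posSemidef hX.1, dotProduct_mulVec_eq_of_mem_completions hX hw.1, hw.2]

theorem IsPartialPosSemidef.exists_pos_mul_sq_le [Fintype V] {G : SimpleGraph V}
    {A : Matrix V V ℝ} (hA : IsPartialPosSemidef G A) {x : V → ℝ}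
    (hx : ∀ w ∈ cliqueKernel G A, x ⬝ᵥ w = 0) :
    ∃ ε > 0, ∀ z, G.IsClique (Function.support z) → ε * (x ⬝ᵥ z) ^ 2 ≤ z ⬝ᵥ A *ᵥ z := by
  classical
  have exists_of_isClique (K : {K : Set V // G.IsClique K}) :
      ∃ ε > 0, ∀ z, Function.support z ⊆ K → ε * (x ⬝ᵥ z) ^ 2 ≤ z ⬝ᵥ A *ᵥ z := by
    have isClique_support (z : Pi.spanSubset ℝ (K : Set V)) : G.IsClique (Function.support z.1) :=
      K.2.subset (Function.support_subset_iff'.2 (Pi.mem_spanSubset_iff.1 z.2))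
    have apply_self (z : Pi.spanSubset ℝ (K : Set V)) :
        (toBilin' A).restrict (Pi.spanSubset ℝ (K : Set V)) z z = z.1 ⬝ᵥ A *ᵥ z.1 :=
      toBilin'_apply' A z z
    obtain ⟨ε, hε, hle⟩ := exists_pos_mul_sq_le_of_posSemidef
      (B := (toBilin' A).restrict (Pi.spanSubset ℝ (K : Set V)))
      (f := (dotProductEquiv ℝ V x).domRestrict _)
      ⟨⟨fun y z => (isSymm_toBilin'_iff_isSymm.2 hA.isSymm).eq y z⟩,
        ⟨fun z => apply_self z ▸ hA.nonneg_of_isClique z (isClique_support z)⟩⟩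
      fun z hz => hx z ⟨isClique_support z, apply_self z ▸ hz⟩
    refine ⟨ε, hε, fun z hz => ?_⟩
    have h := hle ⟨z, Pi.mem_spanSubset_iff.2 (Function.support_subset_iff'.1 hz)⟩
    rwa [apply_self] at h
  choose ε hε hle using exists_of_isClique
  have : Nonempty {K : Set V // G.IsClique K} := ⟨⟨∅, by simp⟩⟩
  obtain ⟨K₀, hK₀⟩ := Finite.exists_min ε
  refine ⟨ε K₀, hε K₀, fun z hz => le_trans ?_ (hle ⟨_, hz⟩ z subset_rfl)⟩
  gcongr
  exact hK₀ _

theorem IsChordal.exists_mem_completions_forall_ker [Fintype V] {G : SimpleGraph V}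
    (hG : IsChordal G) {A : Matrix V V ℝ} (hA : IsPartialPosSemidef G A) {x : V → ℝ}
    (hx : ∀ w ∈ cliqueKernel G A, x ⬝ᵥ w = 0) :
    ∃ Y ∈ completions G A, ∀ z, Y *ᵥ z = 0 → x ⬝ᵥ z = 0 := by
  obtain ⟨ε, hε, hle⟩ := hA.exists_pos_mul_sq_le hx
  have hform (B : Matrix V V ℝ) (z : V → ℝ) :
      z ⬝ᵥ (B + ε • vecMulVec x x) *ᵥ z = z ⬝ᵥ B *ᵥ z + ε * (x ⬝ᵥ z) ^ 2 := by
    simp [add_mulVec, smul_mulVec, vecMulVec_mulVec, dotProduct_comm z x, sq]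
  have hA' : IsPartialPosSemidef G (A - ε • vecMulVec x x) := by
    refine ⟨hA.isSymm.sub ((IsSymm.ext fun i j => mul_comm _ _).smul ε), fun z hz => ?_⟩
    have h := hform (A - ε • vecMulVec x x) z
    rw [sub_add_cancel] at h
    linarith [hle z hz]
  obtain ⟨X, hX, hXA⟩ := hG.completions_nonempty hA'
  refine ⟨X + ε • vecMulVec x x, ⟨hX.add (.smul ?_ hε.le), fun i j hij => ?_⟩, fun z hz => ?_⟩
  · simpa using posSemidef_vecMulVec_self_star x
  · rw [Matrix.add_apply, hXA i j hij, Matrix.sub_apply, sub_add_cancel]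
  · have h := hform X z
    rw [hz, dotProduct_zero] at h
    have hXz : 0 ≤ z ⬝ᵥ X *ᵥ z := hX.dotProduct_mulVec_nonneg z
    have hsq : ε * (x ⬝ᵥ z) ^ 2 ≤ 0 := by linarith
    exact pow_eq_zero_iff two_ne_zero |>.1
      ((nonpos_of_mul_nonpos_right hsq hε).antisymm (sq_nonneg _))

theorem IsChordal.hasStrictlyComplementaryPair [Fintype V] {G : SimpleGraph V} (hG : IsChordal G)
    {A : Matrix V V ℝ} (hA : IsPartialPosSemidef G A) : HasStrictlyComplementaryPair G A := by
  obtain ⟨X, hX⟩ := intrinsicInterior_completions_nonempty (hG.completions_nonempty hA)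
  have hXA := intrinsicInterior_subset hX
  obtain ⟨Ω, hΩ, ker_iff⟩ :=
    exists_isPosSemidefStress_mulVec_eq_zero_iff (W := cliqueKernel G A) fun w hw => hw.1
  refine ⟨X, hXA, Ω, hΩ, Submodule.ext fun x => ?_⟩
  rw [LinearMap.mem_ker, mulVecLin_apply, ker_iff,
    mem_range_mulVecLin_iff_of_isSymm (isSymm_of_posSemidef hXA.1)]
  refine ⟨fun hx z hz => ?_, fun hx w hw => hx w (mulVec_eq_zero_of_mem_cliqueKernel hXA hw)⟩
  obtain ⟨Y, hY, hker⟩ := hG.exists_mem_completions_forall_ker hA hx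
  exact hker z (mulVec_eq_zero_of_mem_intrinsicInterior (fun _ h => h.1) hX hY hz)

theorem stressMatrix_apply_of_ne {G : SimpleGraph V} (ω : V ⊕ G.edgeSet → ℝ) {i j : V}
    (hij : i ≠ j) (hadj : ¬ G.Adj i j) : stressMatrix G ω i j = 0 := by
  simp [stressMatrix, hij, hadj]

theorem exists_stressMatrix_eq {G : SimpleGraph V} {Ω : Matrix V V ℝ} (hΩ : Ω.IsSymm)
    (hG : ∀ i j, i ≠ j → ¬ G.Adj i j → Ω i j = 0) : ∃ ω, stressMatrix G ω = Ω := by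
  refine ⟨Sum.elim (fun i => Ω i i) fun e =>
    2 * Sym2.lift ⟨fun i j => Ω i j, fun i j => (hΩ.apply i j).symm⟩ e.1, ?_⟩
  ext i j
  by_cases hij : i = j
  · simp [stressMatrix, hij]
  · by_cases hadj : G.Adj i j
    · simp [stressMatrix, hij, hadj]
    · rw [stressMatrix_apply_of_ne _ hij hadj, hG i j hij hadj]

open Classical in
theorem sum_sum_dite_adj [Fintype V] {G : SimpleGraph V} (f : G.edgeSet → ℝ) :
    ∑ i, ∑ j, (if h : G.Adj i j then f ⟨s(i, j), h⟩ else 0) = 2 * ∑ e, f e := by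
  let edge (d : G.Dart) : G.edgeSet := ⟨d.edge, d.edge_mem⟩
  have card_fiber (e : G.edgeSet) : (Finset.univ.filter fun d => edge d = e).card = 2 := by
    simpa only [edge, Subtype.ext_iff] using G.dart_edge_fiber_card e.1 e.2
  calc ∑ i, ∑ j, (if h : G.Adj i j then f ⟨s(i, j), h⟩ else 0)
      = ∑ d, f (edge d) := by
        rw [← Fintype.sum_prod_type']
        refine (Fintype.sum_of_injective Dart.toProd Dart.toProd_injective _ _ ?_ ?_).symm
        · exact fun p hp => dif_neg fun h => hp ⟨⟨p, h⟩, rfl⟩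
        · exact fun d => (dif_pos d.adj : dite _ (fun h => f ⟨s(d.fst, d.snd), h⟩) _ = _).symm
    _ = ∑ e, ∑ d with edge d = e, f e := (Finset.sum_fiberwise' _ edge f).symm
    _ = 2 * ∑ e, f e := by
        simp only [Finset.sum_const, card_fiber, Finset.mul_sum, nsmul_eq_mul, Nat.cast_ofNat]

theorem dualValue_eq_trace [Fintype V] {G : SimpleGraph V} {c : G.edgeSet → ℝ}
    {X : Matrix V V ℝ} (hX : X ∈ feasibleSet G c) (ω : V ⊕ G.edgeSet → ℝ) :
    dualValue G c ω = (stressMatrix G ω * X).trace := by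
  classical
  have hsymm : X.IsSymm := isSymm_of_posSemidef hX.1
  have entry_eq (i j : V) : stressMatrix G ω i j * X j i = (if i = j then ω (.inl i) else 0) +
      (if h : G.Adj i j then ω (.inr ⟨s(i, j), h⟩) * c ⟨s(i, j), h⟩ else 0) / 2 := by
    rcases eq_or_ne i j with rfl | hij
    · simp [stressMatrix, hX.2.1]
    · by_cases hadj : G.Adj i j
      · simp [stressMatrix, hij, hadj, hsymm.apply i j, hX.2.2 i j hadj, div_mul_eq_mul_div]
      · simp [stressMatrix, hij, hadj]
  simp only [trace, diag_apply, Matrix.mul_apply, entry_eq, Finset.sum_add_distrib,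
    ← Finset.sum_div, sum_sum_dite_adj fun e => ω (.inr e) * c e]
  simp [dualValue]

theorem feasibleSet_eq_completions {G : SimpleGraph V} {c : G.edgeSet → ℝ} {A : Matrix V V ℝ}
    (hA : A ∈ feasibleSet G c) : feasibleSet G c = completions G A := by
  refine Set.ext fun X => and_congr_right fun _ => ⟨fun hX i j hij => ?_, fun hX => ⟨?_, ?_⟩⟩
  · rcases hij with rfl | hij
    · rw [hX.1, hA.2.1]
    · rw [hX.2 i j hij, hA.2.2 i j hij]
  · exact fun i => (hX i i (.inl rfl)).trans (hA.2.1 i)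
  · exact fun i j hij => (hX i j (.inr hij)).trans (hA.2.2 i j hij)

theorem exists_mem_feasibleSet (G : SimpleGraph V) {A : Matrix V V ℝ} (hA : A.PosSemidef)
    (hdiag : ∀ i, A i i = 1) : ∃ c, A ∈ feasibleSet G c :=
  have hsymm : A.IsSymm := isSymm_of_posSemidef hA
  ⟨fun e => Sym2.lift ⟨fun i j => A i j, fun i j => (hsymm.apply i j).symm⟩ e.1,
    hA, hdiag, fun _ _ _ => rfl⟩

theorem IsPosSemidefStress.mul_eq_zero [Fintype V] {G : SimpleGraph V} {A Ω X Y : Matrix V V ℝ}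
    (hΩ : IsPosSemidefStress G Ω) (hX : X ∈ completions G A) (hY : Y ∈ completions G A)
    (h : Ω * X = 0) : Ω * Y = 0 := by
  have trace_eq : (Ω * Y).trace = (Ω * X).trace := by
    refine Finset.sum_congr rfl fun i _ => Finset.sum_congr rfl fun j _ => ?_
    by_cases hij : j = i ∨ G.Adj j i
    · change Ω i j * Y j i = Ω i j * X j i
      rw [hX.2 j i hij, hY.2 j i hij]
    · rw [not_or, eq_comm, G.adj_comm] at hij
      simp only [hΩ.apply_eq_zero i j hij.1 hij.2, zero_mul]
  exact mul_eq_zero_of_trace_mul_nonpos hΩ.posSemidef hY.1 (by rw [trace_eq, h, trace_zero])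

theorem range_le_ker_iff_mul_eq_zero {l m n R : Type*} [Fintype m] [Fintype n] [CommSemiring R]
    {A : Matrix l m R} {B : Matrix m n R} :
    LinearMap.range B.mulVecLin ≤ LinearMap.ker A.mulVecLin ↔ A * B = 0 := by
  classical
  rw [LinearMap.range_le_ker_iff, ← mulVecLin_mul, ← toLin'_apply', LinearEquiv.map_eq_zero_iff]

theorem ker_eq_range_iff {l m n K : Type*} [Fintype m] [Fintype n] [Field K]
    {A : Matrix l m K} {B : Matrix m n K} :
    LinearMap.ker A.mulVecLin = LinearMap.range B.mulVecLin ↔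
      A * B = 0 ∧ Module.finrank K (LinearMap.ker A.mulVecLin) = B.rank := by
  rw [← range_le_ker_iff_mul_eq_zero, Matrix.rank]
  exact ⟨fun h => ⟨h.ge, by rw [h]⟩, fun h => (Submodule.eq_of_le_of_finrank_eq h.1 h.2.symm).symm⟩

theorem HasStrictlyComplementaryPair.exists_ker_eq_range [Fintype V] {G : SimpleGraph V}
    {A Z : Matrix V V ℝ} (h : HasStrictlyComplementaryPair G A)
    (hZ : Z ∈ intrinsicInterior ℝ (completions G A)) :
    ∃ Ω, IsPosSemidefStress G Ω ∧ LinearMap.ker Ω.mulVecLin = LinearMap.range Z.mulVecLin := by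
  classical
  obtain ⟨X, hX, Ω, hΩ, hker⟩ := h
  have hZA := intrinsicInterior_subset hZ
  refine ⟨Ω, hΩ, le_antisymm (hker.trans_le fun x hx => ?_) ?_⟩
  · rw [mem_range_mulVecLin_iff_of_isSymm (isSymm_of_posSemidef hX.1)] at hx
    rw [mem_range_mulVecLin_iff_of_isSymm (isSymm_of_posSemidef hZA.1)]
    exact fun z hz => hx z (mulVec_eq_zero_of_mem_intrinsicInterior (fun _ h => h.1) hZ hX hz)
  · exact range_le_ker_iff_mul_eq_zero.2
      (hΩ.mul_eq_zero hX hZA (range_le_ker_iff_mul_eq_zero.1 hker.ge))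

theorem finrank_nullCone_zero [Fintype V] (Y : Fin 0 → Matrix V V ℝ) :
    (nullCone Y 0).finrank ℝ = Fintype.card V := by
  have : nullCone Y 0 = Set.univ := Set.eq_univ_of_forall fun _ i => i.elim0
  rw [this, Set.finrank, Submodule.span_univ, finrank_top, Module.finrank_fintype_fun_eq_card]

theorem finrank_nullCone_one [Fintype V] {Y : Fin 1 → Matrix V V ℝ} (hY : (Y 0).PosSemidef) :
    (nullCone Y 1).finrank ℝ = Module.finrank ℝ (LinearMap.ker (Y 0).mulVecLin) := by
  have : nullCone Y 1 = LinearMap.ker (Y 0).mulVecLin := by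
    ext x
    simp [nullCone, Fin.forall_fin_one, mulVec_eq_zero_iff_of_posSemidef hY]
  rw [this, Set.finrank, Submodule.span_eq]

theorem IsFacialReduction.hasStrictlyComplementaryPair [Fintype V] {G : SimpleGraph V}
    {c : G.edgeSet → ℝ} {A : Matrix V V ℝ} (hA : A ∈ feasibleSet G c) {k : ℕ} (hk : k ≤ 1)
    {ω : Fin k → V ⊕ G.edgeSet → ℝ} (hω : IsFacialReduction G c ω) :
    HasStrictlyComplementaryPair G A := by
  obtain ⟨hnest, hval, X, hX, hrank⟩ := hω
  have hXc := intrinsicInterior_subset hX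
  refine ⟨X, feasibleSet_eq_completions hA ▸ hXc, ?_⟩
  obtain rfl | rfl : k = 0 ∨ k = 1 := by omega
  · refine ⟨0, ⟨.zero, fun _ _ _ _ => rfl⟩, ker_eq_range_iff.2 ⟨Matrix.zero_mul X, ?_⟩⟩
    rw [← hrank, finrank_nullCone_zero, mulVecLin_zero, LinearMap.ker_zero, finrank_top,
      Module.finrank_fintype_fun_eq_card]
  · have hΩ : (stressMatrix G (ω 0)).PosSemidef := .of_dotProduct_mulVec_nonneg
      (isHermitian_iff_isSymm.2 (hnest 0).1) fun x =>
        (hnest 0).2 x fun i hi => absurd hi (Nat.not_lt_zero _)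
    refine ⟨_, ⟨hΩ, fun i j => stressMatrix_apply_of_ne _⟩, ker_eq_range_iff.2 ⟨?_, ?_⟩⟩
    · exact mul_eq_zero_of_trace_mul_nonpos hΩ hXc.1 (dualValue_eq_trace hXc (ω 0) ▸ hval 0)
    · rw [← hrank, finrank_nullCone_one hΩ]

theorem HasStrictlyComplementaryPair.exists_isFacialReduction [Fintype V] {G : SimpleGraph V}
    {c : G.edgeSet → ℝ} {A : Matrix V V ℝ} (hA : A ∈ feasibleSet G c)
    (h : HasStrictlyComplementaryPair G A) :
    ∃ ω : Fin 1 → V ⊕ G.edgeSet → ℝ, IsFacialReduction G c ω := by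
  have hcompl := feasibleSet_eq_completions hA
  obtain ⟨Z, hZ⟩ := intrinsicInterior_completions_nonempty ⟨A, hcompl ▸ hA⟩
  obtain ⟨Ω, hΩ, hker⟩ := h.exists_ker_eq_range hZ
  obtain ⟨hmul, hrank⟩ := ker_eq_range_iff.1 hker
  rw [← hcompl] at hZ
  have hsymm : Ω.IsSymm := isSymm_of_posSemidef hΩ.posSemidef
  obtain ⟨ω, rfl⟩ := exists_stressMatrix_eq hsymm hΩ.apply_eq_zero
  refine ⟨fun _ => ω, fun _ => ⟨hsymm, fun x _ => hΩ.posSemidef.dotProduct_mulVec_nonneg x⟩,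
    fun _ => ?_, Z, hZ, (finrank_nullCone_one hΩ.posSemidef).trans hrank⟩
  rw [dualValue_eq_trace (intrinsicInterior_subset hZ), hmul, trace_zero]

theorem weightSingularityDegree_le_iff [Fintype V] {G : SimpleGraph V} {c : G.edgeSet → ℝ}
    {m : ℕ} : weightSingularityDegree G c ≤ m ↔
      ∃ k ≤ m, ∃ ω : Fin k → V ⊕ G.edgeSet → ℝ, IsFacialReduction G c ω := by
  refine ⟨fun h => ?_, fun ⟨k, hk, hω⟩ => (iInf₂_le k hω).trans (Nat.cast_le.2 hk)⟩
  have hlt : weightSingularityDegree G c < (m + 1 : ℕ) :=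
    h.trans_lt (Nat.cast_lt.2 m.lt_succ_self)
  simp only [weightSingularityDegree, iInf_lt_iff, Nat.cast_lt, Nat.lt_succ_iff] at hlt
  obtain ⟨k, hω, hk⟩ := hlt
  exact ⟨k, hk, hω⟩

theorem singularityDegree_le_one_iff [Fintype V] {G : SimpleGraph V} :
    singularityDegree G ≤ 1 ↔ ∀ A : Matrix V V ℝ, A.PosSemidef → (∀ i, A i i = 1) →
      HasStrictlyComplementaryPair G A := by
  simp only [singularityDegree, iSup_le_iff, ← Nat.cast_one (R := ℕ∞),
    weightSingularityDegree_le_iff]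
  constructor
  · intro h A hA hdiag
    obtain ⟨c, hAc⟩ := exists_mem_feasibleSet G hA hdiag
    obtain ⟨k, hk, ω, hω⟩ := h c ⟨A, hAc⟩
    exact hω.hasStrictlyComplementaryPair hAc hk
  · rintro h c ⟨A, hA⟩
    exact ⟨1, le_rfl, (h A hA.1 hA.2.1).exists_isFacialReduction hA⟩

theorem dotProduct_extend_zero {W R : Type*} [Fintype W] [Fintype V] [NonUnitalNonAssocSemiring R]
    {φ : W → V} (hφ : φ.Injective) (y : V → R) (z : W → R) :
    y ⬝ᵥ Function.extend φ z 0 = (y ∘ φ) ⬝ᵥ z := by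
  refine (Fintype.sum_of_injective φ hφ _ _ (fun v hv => ?_) fun w => ?_).symm
  · rw [Function.extend_apply' _ _ _ hv, Pi.zero_apply, mul_zero]
  · rw [hφ.extend_apply, Function.comp_apply]

theorem mulVec_extend_zero_eq_zero_iff {W : Type*} [Fintype W] [Fintype V] {φ : W → V}
    (hφ : φ.Injective) {X : Matrix V V ℝ} (hX : X.PosSemidef) {z : W → ℝ} :
    X *ᵥ Function.extend φ z 0 = 0 ↔ X.submatrix φ φ *ᵥ z = 0 := by
  have hcomp : (X *ᵥ Function.extend φ z 0) ∘ φ = X.submatrix φ φ *ᵥ z :=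
    funext fun w => dotProduct_extend_zero hφ (X (φ w)) z
  rw [mulVec_eq_zero_iff_of_posSemidef hX, mulVec_eq_zero_iff_of_posSemidef (hX.submatrix φ),
    dotProduct_comm, dotProduct_extend_zero hφ, hcomp, dotProduct_comm]

theorem submatrix_mul_submatrix_of_col_eq_zero {W R : Type*} [Fintype W] [Fintype V]
    [NonUnitalNonAssocSemiring R] {φ : W → V} (hφ : φ.Injective) {A B : Matrix V V R}
    (hA : ∀ v ∉ Set.range φ, A.col v = 0) :
    A.submatrix φ φ * B.submatrix φ φ = (A * B).submatrix φ φ := by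
  ext i j
  refine Fintype.sum_of_injective φ hφ _ _ (fun v hv => ?_) fun _ => rfl
  change A.col v (φ i) * B v (φ j) = 0
  rw [hA v hv, Pi.zero_apply, zero_mul]

theorem exists_posSemidef_submatrix_eq {W : Type*} [Finite W] [Finite V] [DecidableEq V]
    (φ : W ↪ V) {B : Matrix W W ℝ} (hB : B.PosSemidef) :
    ∃ A : Matrix V V ℝ, A.PosSemidef ∧ A.submatrix φ φ = B ∧
      ∀ v ∉ Set.range φ, A.col v = Pi.single v 1 := by
  classical
  cases nonempty_fintype W
  cases nonempty_fintype V
  let M : Matrix W V ℝ := Matrix.of fun w v => if φ w = v then 1 else 0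
  have mul_apply_eq (u v) : (Mᵀ * B * M) u v = M.col u ⬝ᵥ B *ᵥ M.col v := by
    rw [Matrix.mul_assoc]; rfl
  have col_apply (w) : M.col (φ w) = Pi.single w 1 := by
    ext w'
    simp [M, Pi.single_apply]
  have col_of_notMem {v} (hv : v ∉ Set.range φ) : M.col v = 0 := by
    ext w
    exact if_neg fun h => hv ⟨w, h⟩
  refine ⟨Mᵀ * B * M + diagonal (Set.indicator (Set.range φ)ᶜ 1), ?_, ?_, fun v hv => ?_⟩
  · exact (hB.conjTranspose_mul_mul_same M).add
      (.diagonal (Set.indicator_nonneg fun _ _ => zero_le_one))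
  · ext i j
    simp [mul_apply_eq, col_apply, diagonal_apply]
  · ext u
    have hdiag : Set.indicator (Set.range φ)ᶜ (1 : V → ℝ) v = 1 := Set.indicator_of_mem hv 1
    simp +contextual [mul_apply_eq, col_of_notMem hv, diagonal_apply, Pi.single_apply, hdiag]

theorem HasStrictlyComplementaryPair.submatrix {W : Type*} [Fintype W] [Fintype V] [DecidableEq V]
    {H : SimpleGraph W} {G : SimpleGraph V} (φ : H ↪g G) {A : Matrix V V ℝ} (hA : A.PosSemidef)
    (hAφ : ∀ v ∉ Set.range φ, A.col v = Pi.single v 1) (h : HasStrictlyComplementaryPair G A) :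
    HasStrictlyComplementaryPair H (A.submatrix φ φ) := by
  obtain ⟨X, hX, Ω, hΩ, hker⟩ := h
  have hΩX : Ω * X = 0 := range_le_ker_iff_mul_eq_zero.1 hker.ge
  have hΩA : Ω * A = 0 := hΩ.mul_eq_zero hX ⟨hA, fun _ _ _ => rfl⟩ hΩX
  have col_eq_zero (v) (hv : v ∉ Set.range φ) : Ω.col v = 0 :=
    calc Ω.col v = Ω *ᵥ A.col v := by rw [hAφ v hv, mulVec_single_one]
      _ = (Ω * A).col v := rfl
      _ = 0 := by rw [hΩA]; rfl
  refine ⟨X.submatrix φ φ, ⟨hX.1.submatrix φ, fun i j hij => ?_⟩, Ω.submatrix φ φ,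
    ⟨hΩ.posSemidef.submatrix φ, fun i j hij hadj => ?_⟩, le_antisymm (fun x hx => ?_) ?_⟩
  · exact hX.2 _ _ (hij.imp (congrArg φ) φ.map_adj_iff.2)
  · exact hΩ.apply_eq_zero _ _ (φ.injective.ne hij) (mt φ.map_adj_iff.1 hadj)
  · have hx' : Function.extend φ x 0 ∈ LinearMap.ker Ω.mulVecLin :=
      (mulVec_extend_zero_eq_zero_iff φ.injective hΩ.posSemidef).2 hx
    rw [hker, mem_range_mulVecLin_iff_of_isSymm (isSymm_of_posSemidef hX.1)] at hx'
    rw [mem_range_mulVecLin_iff_of_isSymm (isSymm_of_posSemidef (hX.1.submatrix φ))]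
    intro z hz
    calc x ⬝ᵥ z = Function.extend φ x 0 ⬝ᵥ Function.extend φ z 0 := by
          rw [dotProduct_extend_zero φ.injective, Function.extend_comp φ.injective]
      _ = 0 := hx' _ ((mulVec_extend_zero_eq_zero_iff φ.injective hX.1).2 hz)
  · rw [range_le_ker_iff_mul_eq_zero,
      submatrix_mul_submatrix_of_col_eq_zero φ.injective col_eq_zero, hΩX, submatrix_zero]
    rfl

theorem apply_eq_apply_of_apply_eq_one [Finite V] {X : Matrix V V ℝ}
    (hX : X.PosSemidef) {a b : V} (ha : X a a = 1) (hb : X b b = 1) (hab : X a b = 1) (i : V) :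
    X i a = X i b := by
  classical
  cases nonempty_fintype V
  have hba : X b a = 1 := ((isSymm_of_posSemidef hX).apply a b).trans hab
  have hker : X *ᵥ (Pi.single a 1 - Pi.single b 1) = 0 := by
    rw [mulVec_eq_zero_iff_of_posSemidef hX]
    simp [mulVec_sub, sub_dotProduct, ha, hb, hab, hba]
  have := congrFun hker i
  rwa [mulVec_sub, mulVec_single_one, mulVec_single_one, Pi.sub_apply, Pi.zero_apply,
    sub_eq_zero] at this

/-- Unit vectors in the plane on the vertices of the cycle of length `m + 4`. The first two
coincide, and so do all but the first three; the third one, at index `2`, is a combination of the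
other two. -/
noncomputable def holeVector (m : ℕ) : Fin (m + 4) → Fin 2 → ℝ
  | ⟨0, _⟩ | ⟨1, _⟩ => ![1, 0]
  | ⟨2, _⟩ => ![3 / 5, 4 / 5]
  | ⟨_ + 3, _⟩ => ![0, 1]

/-- The Gram matrix of `holeVector`. -/
noncomputable def holeGram (m : ℕ) : Matrix (Fin (m + 4)) (Fin (m + 4)) ℝ :=
  of (holeVector m) * (of (holeVector m))ᵀ

theorem posSemidef_holeGram (m : ℕ) : (holeGram m).PosSemidef :=
  posSemidef_self_mul_conjTranspose _

theorem holeGram_apply {m : ℕ} (i j : Fin (m + 4)) :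
    holeGram m i j = holeVector m i ⬝ᵥ holeVector m j := rfl

section Hole

variable {m : ℕ} {X : Matrix (Fin (m + 4)) (Fin (m + 4)) ℝ}

@[simp] theorem holeVector_zero : holeVector m 0 = ![1, 0] := rfl

@[simp] theorem holeVector_one : holeVector m 1 = ![1, 0] := rfl

@[simp] theorem holeVector_two : holeVector m 2 = ![3 / 5, 4 / 5] := rfl

@[simp] theorem holeVector_succ (i : Fin (m + 1)) : holeVector m i.succ.succ.succ = ![0, 1] := rfl

@[simp] theorem holeVector_three : holeVector m 3 = ![0, 1] := rfl

theorem holeGram_apply_self (i : Fin (m + 4)) : holeGram m i i = 1 := by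
  rw [holeGram_apply]
  refine Fin.cases ?_ (Fin.cases ?_ (Fin.cases ?_ fun i => ?_)) i <;> norm_num

theorem apply_self_of_mem_completions_holeGram
    (hX : X ∈ completions (cycleGraph (m + 4)) (holeGram m)) (i : Fin (m + 4)) : X i i = 1 :=
  (hX.2 i i (.inl rfl)).trans (holeGram_apply_self i)

theorem apply_zero_three_of_mem_completions_holeGram
    (hX : X ∈ completions (cycleGraph (m + 4)) (holeGram m)) : X 0 3 = 0 := by
  have apply_self := apply_self_of_mem_completions_holeGram hX
  have apply_zero_eq (i : Fin (m + 1)) : X 0 i.succ.succ.succ = X 0 3 := by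
    induction i using Fin.induction with
    | zero => rfl
    | succ i ih =>
      have hadj : (cycleGraph (m + 4)).Adj i.succ.succ.succ.succ i.castSucc.succ.succ.succ := by
        simp [cycleGraph_adj_succ_succ, pathGraph_adj]
      rw [← ih]
      refine apply_eq_apply_of_apply_eq_one hX.1 (apply_self _) (apply_self _) ?_ 0
      rw [hX.2 _ _ (.inr hadj)]
      simp [holeGram_apply]
  have hadj : (cycleGraph (m + 4)).Adj 0 (Fin.last m).succ.succ.succ :=
    (cycleGraph_adj_zero_succ _).2 (.inr rfl)
  rw [← apply_zero_eq (Fin.last m), hX.2 _ _ (.inr hadj), holeGram_apply, holeVector_succ]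
  simp

theorem mulVec_eq_zero_of_mem_completions_holeGram
    (hX : X ∈ completions (cycleGraph (m + 4)) (holeGram m)) :
    X *ᵥ ((3 : ℝ) • Pi.single 0 1 + (4 : ℝ) • Pi.single 3 1 - (5 : ℝ) • Pi.single 2 1) = 0 := by
  have apply_self := apply_self_of_mem_completions_holeGram hX
  have h01 : X 0 1 = 1 := by
    rw [hX.2 0 1 (.inr ((cycleGraph_adj_zero_succ 0).2 (.inl rfl)))]
    simp [holeGram_apply]
  have h21 : X 2 1 = 3 / 5 := by
    rw [hX.2 2 1 (.inr ((cycleGraph_adj_succ_succ 1 0).2 (pathGraph_adj.2 (.inr rfl))))]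
    simp [holeGram_apply]
  have h23 : X 2 3 = 4 / 5 := by
    rw [hX.2 2 3 (.inr ((cycleGraph_adj_succ_succ 1 2).2 (pathGraph_adj.2 (.inl rfl))))]
    simp [holeGram_apply]
  have h20 : X 2 0 = 3 / 5 :=
    (apply_eq_apply_of_apply_eq_one hX.1 (apply_self 0) (apply_self 1) h01 2).trans h21
  have h03 : X 0 3 = 0 := apply_zero_three_of_mem_completions_holeGram hX
  have hsymm := isSymm_of_posSemidef hX.1
  have h02 : X 0 2 = 3 / 5 := (hsymm.apply 2 0).trans h20
  have h32 : X 3 2 = 4 / 5 := (hsymm.apply 2 3).trans h23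
  have h30 : X 3 0 = 0 := (hsymm.apply 0 3).trans h03
  rw [mulVec_eq_zero_iff_of_posSemidef hX.1]
  simp only [mulVec_sub, mulVec_add, mulVec_smul, mulVec_single_one, sub_dotProduct, add_dotProduct,
    smul_dotProduct, single_one_dotProduct, Pi.sub_apply, Pi.add_apply, Pi.smul_apply, col_apply,
    smul_eq_mul, apply_self, h02, h20, h03, h30, h23, h32]
  norm_num

theorem sum_univ_succ_succ_succ {M : Type*} [AddCommMonoid M] (f : Fin (m + 4) → M) :
    ∑ i, f i = f 0 + (f 1 + (f 2 + ∑ i : Fin (m + 1), f i.succ.succ.succ)) := by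
  rw [Fin.sum_univ_succ, Fin.sum_univ_succ, Fin.sum_univ_succ]
  rfl

theorem IsPosSemidefStress.mulVec_single_two_eq_zero {Ω : Matrix (Fin (m + 4)) (Fin (m + 4)) ℝ}
    (hΩ : IsPosSemidefStress (cycleGraph (m + 4)) Ω) (h : Ω * holeGram m = 0) :
    Ω *ᵥ Pi.single 2 1 = 0 := by
  have hmul : Ω * of (holeVector m) = 0 := (mul_self_mul_conjTranspose_eq_zero _ _).1 h
  have sum_eq_zero (i k) : ∑ j, Ω i j * holeVector m j k = 0 := congrFun₂ hmul i k
  have h13 (j : Fin (m + 1)) : Ω 1 j.succ.succ.succ = 0 := by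
    refine hΩ.apply_eq_zero (Fin.succ 0) _ ?_ ?_
    · exact (Fin.succ_injective _).ne (Fin.succ_ne_zero _).symm
    · exact mt (cycleGraph_adj_succ_succ 0 j.succ.succ).1 (by simp [pathGraph_adj])
  have h20 : Ω 2 0 = 0 := by
    refine hΩ.apply_eq_zero _ _ (Fin.succ_ne_zero (1 : Fin (m + 3))) fun h => ?_
    simpa [Fin.ext_iff] using (cycleGraph_adj_zero_succ (Fin.succ 0)).1 h.symm
  have h12 : Ω 1 2 = 0 := by
    simpa [sum_univ_succ_succ_succ, h13] using sum_eq_zero 1 1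
  have h21 : Ω 2 1 = 0 := ((isSymm_of_posSemidef hΩ.posSemidef).apply 1 2).trans h12
  have h22 : Ω 2 2 = 0 := by
    simpa [sum_univ_succ_succ_succ, h20, h21] using sum_eq_zero 2 0
  rw [mulVec_eq_zero_iff_of_posSemidef hΩ.posSemidef]
  simpa using h22

theorem not_hasStrictlyComplementaryPair_holeGram (m : ℕ) :
    ¬ HasStrictlyComplementaryPair (cycleGraph (m + 4)) (holeGram m) := by
  rintro ⟨X, hX, Ω, hΩ, hker⟩
  have hmem : Pi.single 2 1 ∈ LinearMap.range X.mulVecLin := by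
    rw [← hker]
    exact hΩ.mulVec_single_two_eq_zero (hΩ.mul_eq_zero hX
      ⟨posSemidef_holeGram m, fun _ _ _ => rfl⟩ (range_le_ker_iff_mul_eq_zero.1 hker.ge))
  rw [mem_range_mulVecLin_iff_of_isSymm (isSymm_of_posSemidef hX.1)] at hmem
  have hdot := hmem _ (mulVec_eq_zero_of_mem_completions_holeGram hX)
  have h02 : (0 : Fin (m + 4)) ≠ 2 := (Fin.succ_ne_zero 1).symm
  have h32 : (3 : Fin (m + 4)) ≠ 2 := Fin.ne_of_val_ne (show (3 : ℕ) ≠ 2 by decide)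
  simp [h02.symm, h32.symm] at hdot

end Hole

theorem isChordal_of_forall_hasStrictlyComplementaryPair [Fintype V] {G : SimpleGraph V}
    (h : ∀ A : Matrix V V ℝ, A.PosSemidef → (∀ i, A i i = 1) → HasStrictlyComplementaryPair G A) :
    IsChordal G := by
  classical
  refine fun n hn => ⟨fun φ => ?_⟩
  obtain ⟨m, rfl⟩ := Nat.exists_eq_add_of_le' hn
  obtain ⟨A, hA, hAφ, hcol⟩ := exists_posSemidef_submatrix_eq φ.toEmbedding (posSemidef_holeGram m)
  have hdiag (v : V) : A v v = 1 := by
    by_cases hv : v ∈ Set.range φ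
    · obtain ⟨i, rfl⟩ := hv
      exact (congrFun₂ hAφ i i).trans (holeGram_apply_self i)
    · simpa using congrFun (hcol v hv) v
  exact not_hasStrictlyComplementaryPair_holeGram m (hAφ ▸ (h A hA hdiag).submatrix φ hA hcol)

end PSDCompletion

theorem theorem4p2 {V : Type*} [Fintype V] (G : SimpleGraph V) :
    PSDCompletion.singularityDegree G ≤ 1 ↔ PSDCompletion.IsChordal G :=
  PSDCompletion.singularityDegree_le_one_iff.trans
    ⟨PSDCompletion.isChordal_of_forall_hasStrictlyComplementaryPair, fun hG _ hA _ =>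
      hG.hasStrictlyComplementaryPair (.of_posSemidef G hA)⟩
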